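/- **Theorem 1 (Theorem 0 in the journal version).** Let $G$ be a (not necessarily finite) group, let $m\ge 1$, and consider a (not necessarily finite) system of equations $\{u_i(x_1,\dots,x_m)=1\mid i\in I\}$ over $G$, where each $u_i$ is a word whose letters are the unknowns $x_1,\dots,x_m$, their inverses, and elements of $G$ (called coefficients). Let $C$ be the centraliser in $G$ of the set of all coefficients of the system. Let $A=(a_{ij})$ be the matrix of the system: the integer matrix in which $a_{ij}$ is the exponent sum of the $j$-th unknown in the $i$-th equation. Let $\Delta_k$ be the greatest common divisor of all minors of order $k$ of $A$, with the conventions that $\Delta_0=1$, that $\Delta_k=0$ if $k$ is larger than the number of equations, and that $\frac00=0$. Then the number of solutions of the system in $G$ (that is, the cardinality of the set of all $(g_1,\dots,g_m)\in G^m$ satisfying all equations) is divisible by $$\mathrm{GCD}\left(C,\ \frac{\Delta_m}{\Delta_{m-1}}\right).$$ Here, for a group $H$ and an integer $n$, $\mathrm{GCD}(H,n)$ denotes the least common multiple of the orders of those subgroups of $H$ whose order divides $n$. Divisibility is understood in the sense of cardinal arithmetic: an infinite cardinal is divisible by all nonzero cardinals not exceeding it, and zero is divisible by all cardinals and divides only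 zero. (In particular, $\mathrm{GCD}(H,0)=|H|$, and $\mathrm{GCD}(H,n)=\mathrm{gcd}(|H|,n)$ if $H$ is finite.) -/

import Mathlib

universe u v

namespace GroupEquations

/-- A letter of the left-hand side of an equation over a group `G` in the unknowns
`x_0, …, x_{m-1}`: a coefficient from `G`, an unknown, or the inverse of an unknown. -/
inductive Letter (G : Type u) (m : ℕ) : Type u
  | coeff (g : G) : Letter G m
  | unknown (j : Fin m) : Letter G m
  | unknownInv (j : Fin m) : Letter G m

/-- The value of a letter when the unknowns take the values `x`. -/
def Letter.eval {G : Type u} [Group G] {m : ℕ} (x : Fin m → G) : Letter G m → G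
  | .coeff g => g
  | .unknown j => x j
  | .unknownInv j => (x j)⁻¹

/-- The contribution of a letter to the exponent sum of the `j`-th unknown. -/
def Letter.exponent {G : Type u} {m : ℕ} (j : Fin m) : Letter G m → ℤ
  | .coeff _ => 0
  | .unknown i => if i = j then 1 else 0
  | .unknownInv i => if i = j then -1 else 0

/-- A word `v(x_0, …, x_{m-1})`; it stands for the equation `v(x_0, …, x_{m-1}) = 1`. -/
abbrev Word (G : Type u) (m : ℕ) : Type u := List (Letter G m)

/-- The value in `G` of a word when the unknowns take the values `x`. -/
def Word.eval {G : Type u} [Group G] {m : ℕ} (x : Fin m → G) (w : Word G m) : G :=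
  (w.map (Letter.eval x)).prod

/-- The exponent sum of the `j`-th unknown in a word. -/
def Word.exponentSum {G : Type u} {m : ℕ} (w : Word G m) (j : Fin m) : ℤ :=
  (w.map (Letter.exponent j)).sum

/-- A system of equations `u i = 1`, `i ∈ I`, over `G` in `m` unknowns; `I` may be infinite. -/
abbrev System (G : Type u) (I : Type v) (m : ℕ) : Type (max u v) := I → Word G m

/-- The set of solutions in `G` of a system. -/
def System.solutions {G : Type u} [Group G] {I : Type v} {m : ℕ} (S : System G I m) :
    Set (Fin m → G) :=
  {x | ∀ i, (S i).eval x = 1}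

/-- The set of coefficients of a system: the elements of `G` occurring in its words. -/
def System.coefficients {G : Type u} {I : Type v} {m : ℕ} (S : System G I m) : Set G :=
  {g | ∃ i, Letter.coeff g ∈ S i}

/-- The matrix of a system: its `(i, j)` entry is the exponent sum of the `j`-th unknown in the
`i`-th equation. -/
def System.matrix {G : Type u} {I : Type v} {m : ℕ} (S : System G I m) : Matrix I (Fin m) ℤ :=
  Matrix.of fun i j => (S i).exponentSum j

/-- The minors of order `k` of an integer matrix: determinants of submatrices on `k` distinct rows
and `k` distinct columns (each minor appears with both signs when `k ≥ 2`, which does not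
affect greatest common divisors). -/
def minors {I : Type v} {m : ℕ} (A : Matrix I (Fin m) ℤ) (k : ℕ) : Set ℤ :=
  {d | ∃ (r : Fin k ↪ I) (c : Fin k ↪ Fin m), d = (A.submatrix r c).det}

/-- The nonnegative greatest common divisor of a possibly infinite set of integers; it is `0` if
the set has no nonzero elements, in particular if the set is empty. -/
noncomputable def gcdSet (s : Set ℤ) : ℕ :=
  (Submodule.IsPrincipal.generator (Ideal.span s)).natAbs

theorem dvd_gcdSet_iff (s : Set ℤ) (d : ℤ) : d ∣ (gcdSet s : ℤ) ↔ ∀ a ∈ s, d ∣ a := by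
  rw [gcdSet, Int.dvd_natAbs, ← Ideal.mem_span_singleton, ← Ideal.span_singleton_le_iff_mem,
    Ideal.span_singleton_generator, Ideal.span_le]
  simp only [Set.subset_def, SetLike.mem_coe, Ideal.mem_span_singleton]

/-- `Δ_k`: the greatest common divisor of all minors of order `k`. In particular `Δ_0 = 1`, and
`Δ_k = 0` if `k` is larger than the number of rows. -/
noncomputable def Delta {I : Type v} {m : ℕ} (A : Matrix I (Fin m) ℤ) (k : ℕ) : ℕ :=
  gcdSet (minors A k)

/-- The least common multiple of a set of nonzero cardinals: the least nonzero cardinal divisible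
by all of them. -/
noncomputable def cardinalLcm (s : Set Cardinal.{u}) : Cardinal.{u} :=
  sInf {c | c ≠ 0 ∧ ∀ a ∈ s, a ∣ c}

/-- The greatest common divisor `GCD(G, n)` of a group `G` and an integer `n ≥ 0`: the least
common multiple of the orders of those subgroups of `G` whose order divides `n`. -/
noncomputable def groupGcd (G : Type u) [Group G] (n : ℕ) : Cardinal.{u} :=
  cardinalLcm {c | ∃ H : Subgroup G, c = Cardinal.mk H ∧ c ∣ (n : Cardinal.{u})}

end GroupEquations

/-!
Consider the free group `F` on `G` and the unknowns. Solutions of the system are homomorphisms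
`F → G` with prescribed values on `G` that kill the equations. Put `n = Δ_m / Δ_{m-1}`. The Smith
normal form of the row span gives a surjective linear form `ℤ^m → ℤ` whose values on the rows are
divisible by `n`, and hence a surjective degree map `F → ℤ/n` that kills `G` and the equations.

Let a subgroup `H` of the centralizer, with `|H|` dividing `n`, act on these homomorphisms by
conjugation. Group them into classes: `ψ` is in the class of `φ` if it agrees with `φ` in degree
zero and differs from it by values in the largest subgroup `U` of `H` that centralizes the image
of degree zero and is normalized by the image of `φ`. The stabilizer of the class of `φ` is `U`.
The class itself also has `|U|` elements: `ψ` is determined by its value `φ t * u` at an element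
`t` of degree one, and every `u ∈ U` occurs since `(φ t * u) ^ n = (φ t) ^ n` by a lemma of Brauer.
Orbit counting on the set of classes (the argument behind Burnside's lemma, which holds for
infinite cardinals) now shows that `|H|` divides the number of homomorphisms.
-/

namespace GroupEquations

theorem cardinalLcm_dvd {s : Set Cardinal.{u}} {c : Cardinal.{u}} (h : ∀ a ∈ s, a ∣ c) :
    cardinalLcm s ∣ c := by
  rcases eq_or_ne c 0 with rfl | hc
  · exact dvd_zero _
  obtain ⟨lcm_ne_zero, dvd_lcm⟩ : cardinalLcm s ≠ 0 ∧ ∀ a ∈ s, a ∣ cardinalLcm s :=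
    csInf_mem (s := {b | b ≠ 0 ∧ ∀ a ∈ s, a ∣ b}) ⟨c, hc, h⟩
  have lcm_le {b : Cardinal.{u}} (hb : b ≠ 0) (hs : ∀ a ∈ s, a ∣ b) : cardinalLcm s ≤ b :=
    csInf_le' ⟨hb, hs⟩
  rcases le_or_gt Cardinal.aleph0 c with c_infinite | c_finite
  · exact Cardinal.dvd_of_le_of_aleph0_le lcm_ne_zero (lcm_le hc h) c_infinite
  obtain ⟨k, rfl⟩ := Cardinal.lt_aleph0.1 c_finite
  obtain ⟨l, hl⟩ := Cardinal.lt_aleph0.1 ((lcm_le hc h).trans_lt c_finite)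
  rw [hl] at lcm_ne_zero dvd_lcm lcm_le ⊢
  have dvd_mod : ∀ a ∈ s, a ∣ ((k % l : ℕ) : Cardinal.{u}) := fun a ha => by
    obtain ⟨b, rfl⟩ := Cardinal.lt_aleph0.1 ((Cardinal.le_of_dvd hc (h a ha)).trans_lt c_finite)
    rw [Cardinal.nat_coe_dvd_iff]
    exact (Nat.dvd_mod_iff (Cardinal.nat_coe_dvd_iff.1 (dvd_lcm _ ha))).2
      (Cardinal.nat_coe_dvd_iff.1 (h _ ha))
  rw [Cardinal.nat_coe_dvd_iff]
  refine Nat.dvd_of_mod_eq_zero (by_contra fun mod_ne_zero => ?_)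
  exact (Nat.mod_lt k (Nat.pos_of_ne_zero (mod_cast lcm_ne_zero))).not_ge
    (Nat.cast_le.1 (lcm_le (mod_cast mod_ne_zero) dvd_mod))

theorem groupGcd_dvd_of_forall_le {G : Type u} [Group G] {K : Subgroup G} {n : ℕ} {c : Cardinal.{u}}
    (h : ∀ H ≤ K, Cardinal.mk H ∣ (n : Cardinal.{u}) → Cardinal.mk H ∣ c) :
    groupGcd K n ∣ c := by
  refine cardinalLcm_dvd ?_
  rintro _ ⟨H, rfl, hH⟩
  rw [Cardinal.mk_congr (H.equivMapOfInjective K.subtype K.subtype_injective).toEquiv] at hH ⊢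
  exact h _ (Subgroup.map_subtype_le H) hH

theorem mk_dvd_mk_of_smulCon {H X : Type u} [Group H] [MulAction H X] (c : SMulCon H X)
    (hc : ∀ x, Cardinal.mk {y // c.toSetoid y x} = Cardinal.mk {h : H // c.toSetoid (h • x) x}) :
    Cardinal.mk H ∣ Cardinal.mk X := by
  have fiber_equiv_stabilizer (y : c.Quotient) :
      Nonempty ({x // Quotient.mk c.toSetoid x = y} ≃ {h : H // h • y = y}) := by
    induction y using Quotient.inductionOn with
    | _ x =>
      obtain ⟨e⟩ := Cardinal.eq.1 (hc x)
      exact ⟨((Equiv.subtypeEquivRight fun _ => Quotient.eq).trans e).trans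
        (Equiv.subtypeEquivRight fun _ => Quotient.eq.symm)⟩
  have e : X ≃ Quotient (MulAction.orbitRel H c.Quotient) × H :=
    calc
      X ≃ Σ y : c.Quotient, {x // Quotient.mk c.toSetoid x = y} :=
        (Equiv.sigmaFiberEquiv _).symm
      _ ≃ Σ y : c.Quotient, {h : H // h • y = y} :=
        Equiv.sigmaCongrRight fun y => (fiber_equiv_stabilizer y).some
      _ ≃ Σ h : H, MulAction.fixedBy c.Quotient h :=
        { toFun := fun p => ⟨p.2.1, p.1, p.2.2⟩
          invFun := fun p => ⟨p.2.1, p.1, p.2.2⟩ }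
      _ ≃ Quotient (MulAction.orbitRel H c.Quotient) × H :=
        MulAction.sigmaFixedByEquivOrbitsProdGroup H c.Quotient
  rw [Cardinal.mk_congr e, Cardinal.mk_prod, Cardinal.lift_id, Cardinal.lift_id]
  exact dvd_mul_left _ _

section Brauer

theorem dvd_card_of_dvd_minimalPeriod {X : Type*} [Finite X] (σ : Equiv.Perm X) {q : ℕ}
    (h : ∀ x, q ∣ Function.minimalPeriod σ x) : q ∣ Nat.card X := by
  classical
  have := Fintype.ofFinite X
  have := Fintype.ofFinite (Quotient (MulAction.orbitRel (Subgroup.zpowers σ) X))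
  rw [Nat.card_congr (MulAction.selfEquivSigmaOrbits (Subgroup.zpowers σ) X), Nat.card_sigma]
  refine Finset.dvd_sum fun ω _ => ?_
  rw [Nat.card_eq_fintype_card, ← MulAction.minimalPeriod_eq_card]
  exact h _

theorem eq_one_of_minimalPeriod_iterate_eq {X : Type*} [Finite X] [Nonempty X]
    (σ : Equiv.Perm X) {n d : ℕ} (hn : Nat.card X ∣ n)
    (hd : ∀ x, Function.minimalPeriod σ^[n] x = d) : d = 1 := by
  have period_eq (x : X) :
      Function.minimalPeriod σ x = d * Nat.gcd (Function.minimalPeriod σ x) n := by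
    rw [← hd x, Function.minimalPeriod_iterate_eq_div_gcd' (σ.injective.mem_periodicPts x),
      Nat.div_mul_cancel (Nat.gcd_dvd_left _ _)]
  -- A power of `d` dividing every period divides `Nat.card X`, hence `n`, and so each gcd above.
  have pow_dvd_period (j : ℕ) : ∀ x, d ^ j ∣ Function.minimalPeriod σ x := by
    induction j with
    | zero => simp
    | succ j ih =>
      intro x
      rw [period_eq x, pow_succ']
      exact mul_dvd_mul_left d
        (Nat.dvd_gcd (ih x) ((dvd_card_of_dvd_minimalPeriod σ ih).trans hn))
  have pow_le_card (j : ℕ) : d ^ j ≤ Nat.card X :=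
    Nat.le_of_dvd Nat.card_pos (dvd_card_of_dvd_minimalPeriod σ (pow_dvd_period j))
  have d_pos : 0 < d := by
    obtain ⟨x⟩ := ‹Nonempty X›
    rw [← hd x]
    exact Function.minimalPeriod_pos_of_mem_periodicPts
      ((σ.injective.iterate n).mem_periodicPts x)
  by_contra hne
  exact (pow_le_card (Nat.card X)).not_gt (Nat.lt_pow_self (by lia))

variable {G : Type*} [Group G] {U : Subgroup G} {a u : G}

theorem minimalPeriod_mul_left_eq_orderOf (v x : G) :
    Function.minimalPeriod (v * ·) x = orderOf v :=
  Function.minimalPeriod_eq_minimalPeriod_iff.2 fun k => by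
    rw [isPeriodicPt_mul_iff_pow_eq_one, Function.IsPeriodicPt, Function.IsFixedPt,
      mul_left_iterate]
    exact mul_eq_right

theorem inv_zpow_mul_mul_zpow_mem (ha : a ∈ Subgroup.normalizer (U : Set G)) (hu : u ∈ U)
    (k : ℤ) : (a ^ k)⁻¹ * (a * u) ^ k ∈ U := by
  let a' : Subgroup.normalizer (U : Set G) := ⟨a, ha⟩
  let u' : Subgroup.normalizer (U : Set G) := ⟨u, Subgroup.le_normalizer hu⟩
  have hu' : (u' : _ ⧸ U.subgroupOf (Subgroup.normalizer (U : Set G))) = 1 :=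
    (QuotientGroup.eq_one_iff u').2 hu
  have : ((a' ^ k : _) : _ ⧸ U.subgroupOf (Subgroup.normalizer (U : Set G))) =
      ((a' * u') ^ k : _) := by
    rw [QuotientGroup.mk_zpow, QuotientGroup.mk_zpow, QuotientGroup.mk_mul, hu', mul_one]
  exact Subgroup.mem_subgroupOf.1 (QuotientGroup.eq.1 this)

theorem mul_pow_eq_pow_of_mem_normalizer [Finite U] {n : ℕ}
    (ha : a ∈ Subgroup.normalizer (U : Set G)) (hu : u ∈ U) (hn : Nat.card U ∣ n)
    (hc : a ^ n ∈ Subgroup.centralizer (U : Set G)) : (a * u) ^ n = a ^ n := by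
  let σ : Equiv.Perm U :=
    (Equiv.mulLeft ⟨u, hu⟩).trans (U.normalizerMonoidHom ⟨a, ha⟩).toEquiv
  let v : U := ⟨(a ^ n)⁻¹ * (a * u) ^ n, mod_cast inv_zpow_mul_mul_zpow_mem ha hu n⟩
  have iterate_σ (k : ℕ) (x : U) : ((σ^[k] x : U) : G) = (a * u) ^ k * x * (a ^ k)⁻¹ := by
    induction k with
    | zero => simp
    | succ k ih =>
      rw [Function.iterate_succ_apply', pow_succ' (a * u), pow_succ' a]
      change a * (u * (σ^[k] x : U)) * a⁻¹ = _
      rw [ih]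
      group
  have iterate_σ_eq_mul : σ^[n] = (v * ·) := by
    funext x
    refine Subtype.ext ?_
    rw [iterate_σ, mul_inv_eq_iff_eq_mul, Subgroup.mem_centralizer_iff.1 hc _ (v * x).2]
    simp [v, mul_assoc]
  have hv : orderOf v = 1 := eq_one_of_minimalPeriod_iterate_eq σ hn fun x => by
    rw [iterate_σ_eq_mul, minimalPeriod_mul_left_eq_orderOf]
  exact (inv_mul_eq_one.1 (congrArg Subtype.val (orderOf_eq_one_iff.1 hv))).symm

end Brauer

/-- The action of `G` on homomorphisms into `G` by composition with inner automorphisms. -/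
local instance conjAction {F G : Type*} [Group F] [Group G] : MulAction G (F →* G) where
  smul g φ := (MulAut.conj g).toMonoidHom.comp φ
  one_smul φ := MonoidHom.ext fun w => by
    change 1 * φ w * 1⁻¹ = φ w
    simp
  mul_smul g h φ := MonoidHom.ext fun w => by
    change g * h * φ w * (g * h)⁻¹ = g * (h * φ w * h⁻¹) * g⁻¹
    group

section Core

variable {F G : Type*} [Group F] [Group G]

theorem conj_smul_apply (g : G) (φ : F →* G) (w : F) : (g • φ) w = g * φ w * g⁻¹ := rfl

/-- The largest subgroup of `H` that centralizes `φ N` and is normalized by the image of `φ`: the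
elements by which the values of `φ` may be modified without changing `φ` on `N`. -/
def conjCore (N : Subgroup F) (H : Subgroup G) (φ : F →* G) : Subgroup G :=
  ⨅ w, (H ⊓ Subgroup.centralizer (φ '' N)).comap (MulAut.conj (φ w)).toMonoidHom

variable {N : Subgroup F} {H : Subgroup G} {φ ψ χ : F →* G} {x : G}

theorem mem_conjCore_iff :
    x ∈ conjCore N H φ ↔
      ∀ w, φ w * x * (φ w)⁻¹ ∈ H ∧ ∀ a ∈ N, Commute (φ a) (φ w * x * (φ w)⁻¹) := by
  simp only [conjCore, Subgroup.mem_iInf, Subgroup.mem_comap, Subgroup.mem_inf,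
    Subgroup.mem_centralizer_iff, Set.forall_mem_image, SetLike.mem_coe]
  rfl

theorem conjCore_le : conjCore N H φ ≤ H := fun x hx => by
  simpa using (mem_conjCore_iff.1 hx 1).1

theorem commute_of_mem_conjCore (hx : x ∈ conjCore N H φ) {a : F} (ha : a ∈ N) :
    Commute (φ a) x := by
  simpa using (mem_conjCore_iff.1 hx 1).2 a ha

theorem conj_mem_conjCore (hx : x ∈ conjCore N H φ) (w : F) :
    φ w * x * (φ w)⁻¹ ∈ conjCore N H φ :=
  mem_conjCore_iff.2 fun v => by
    simpa [mul_assoc] using mem_conjCore_iff.1 hx (v * w)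

theorem map_mem_normalizer_conjCore (w : F) :
    φ w ∈ Subgroup.normalizer (conjCore N H φ : Set G) :=
  Subgroup.mem_normalizer_iff.2 fun x =>
    ⟨fun hx => conj_mem_conjCore hx w, fun hx => by
      simpa [mul_assoc] using conj_mem_conjCore hx w⁻¹⟩

/-- The relation between homomorphisms that agree on `N` and differ by elements of the core. It cuts
the set of homomorphisms into classes of the size of their cores. -/
structure Close (N : Subgroup F) (H : Subgroup G) (φ ψ : F →* G) : Prop where
  eqOn : ∀ a ∈ N, ψ a = φ a
  inv_mul_mem : ∀ w, (φ w)⁻¹ * ψ w ∈ conjCore N H φ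

theorem Close.conjCore_le (h : Close N H φ ψ) : conjCore N H φ ≤ conjCore N H ψ := by
  intro x hx
  refine mem_conjCore_iff.2 fun w => ?_
  have hu := h.inv_mul_mem w
  have key := mem_conjCore_iff.1 (mul_mem (mul_mem hu hx) (inv_mem hu)) w
  have conj_eq :
      φ w * ((φ w)⁻¹ * ψ w * x * ((φ w)⁻¹ * ψ w)⁻¹) * (φ w)⁻¹ = ψ w * x * (ψ w)⁻¹ := by
    group
  rw [conj_eq] at key
  exact ⟨key.1, fun a ha => h.eqOn a ha ▸ key.2 a ha⟩

theorem Close.refl (φ : F →* G) : Close N H φ φ :=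
  ⟨fun _ _ => rfl, fun w => by simp⟩

theorem Close.symm (h : Close N H φ ψ) : Close N H ψ φ :=
  ⟨fun a ha => (h.eqOn a ha).symm, fun w => by
    simpa using inv_mem (h.conjCore_le (h.inv_mul_mem w))⟩

theorem Close.trans (h : Close N H φ ψ) (h' : Close N H ψ χ) : Close N H φ χ :=
  ⟨fun a ha => (h'.eqOn a ha).trans (h.eqOn a ha), fun w => by
    simpa [mul_assoc] using mul_mem (h.inv_mul_mem w) (h.symm.conjCore_le (h'.inv_mul_mem w))⟩

theorem conj_mem_conjCore_smul {h : G} (hh : h ∈ H) (hx : x ∈ conjCore N H φ) :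
    h * x * h⁻¹ ∈ conjCore N H (h • φ) := by
  refine mem_conjCore_iff.2 fun w => ?_
  obtain ⟨mem_H, commute_N⟩ := mem_conjCore_iff.1 hx w
  have conj_eq : (h • φ) w * (h * x * h⁻¹) * ((h • φ) w)⁻¹ = h * (φ w * x * (φ w)⁻¹) * h⁻¹ := by
    rw [conj_smul_apply]
    group
  rw [conj_eq]
  exact ⟨mul_mem (mul_mem hh mem_H) (inv_mem hh), fun a ha => (commute_N a ha).conj h⟩

theorem Close.smul {h : G} (hh : h ∈ H) (hφψ : Close N H φ ψ) : Close N H (h • φ) (h • ψ) :=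
  ⟨fun a ha => by rw [conj_smul_apply, conj_smul_apply, hφψ.eqOn a ha], fun w => by
    simpa [conj_smul_apply, mul_assoc] using conj_mem_conjCore_smul hh (hφψ.inv_mul_mem w)⟩

theorem close_smul_iff {h : G} (hh : h ∈ H) : Close N H φ (h • φ) ↔ h ∈ conjCore N H φ := by
  constructor
  · rintro ⟨eq_on_N, diff_mem⟩
    have commute_h (a : F) (ha : a ∈ N) : Commute (φ a) h :=
      (mul_inv_eq_iff_eq_mul.1 (eq_on_N a ha)).symm
    refine mem_conjCore_iff.2 fun w => ?_
    have conj_eq : φ w * h * (φ w)⁻¹ = ((φ w⁻¹)⁻¹ * (h • φ) w⁻¹) * h := by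
      simp [conj_smul_apply, mul_assoc]
    rw [conj_eq]
    exact ⟨mul_mem (conjCore_le (diff_mem w⁻¹)) hh, fun a ha =>
      (commute_of_mem_conjCore (diff_mem w⁻¹) ha).mul_right (commute_h a ha)⟩
  · intro hcore
    refine ⟨fun a ha => ?_, fun w => ?_⟩
    · rw [conj_smul_apply, ← (commute_of_mem_conjCore hcore ha).eq, mul_inv_cancel_right]
    · simpa [conj_smul_apply, mul_assoc] using
        mul_mem (conj_mem_conjCore hcore w⁻¹) (inv_mem hcore)

variable {n : ℕ} {deg : F →* Multiplicative (ZMod n)} {t : F}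

theorem mul_inv_zpow_mem_ker (ht : deg t = Multiplicative.ofAdd 1) {w : F} {k : ℤ}
    (hk : deg w = Multiplicative.ofAdd (k : ZMod n)) : w * (t ^ k)⁻¹ ∈ deg.ker := by
  rw [MonoidHom.mem_ker, map_mul, map_inv, map_zpow, ht, hk, ← ofAdd_zsmul, zsmul_one,
    mul_inv_cancel]

theorem exists_deg_eq_intCast (deg : F →* Multiplicative (ZMod n)) (w : F) :
    ∃ k : ℤ, deg w = Multiplicative.ofAdd (k : ZMod n) :=
  ⟨(deg w).toAdd.cast, by rw [ZMod.intCast_zmod_cast, ofAdd_toAdd]⟩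

theorem inv_zpow_mul_zpow_congr {a b : G} (hab : b ^ n = a ^ n) {k l : ℤ}
    (hkl : (k : ZMod n) = l) : (a ^ k)⁻¹ * b ^ k = (a ^ l)⁻¹ * b ^ l := by
  obtain ⟨c, hc⟩ := (ZMod.intCast_eq_intCast_iff_dvd_sub l k n).1 hkl.symm
  rw [sub_eq_iff_eq_add.1 hc]
  simp only [zpow_add, zpow_mul, zpow_natCast, hab, mul_inv_rev, mul_assoc,
    inv_mul_cancel_left]

theorem eq_of_eqOn_ker (ht : deg t = Multiplicative.ofAdd 1)
    (hker : ∀ a ∈ deg.ker, ψ a = φ a) (htφ : ψ t = φ t) : ψ = φ := by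
  ext w
  obtain ⟨k, hk⟩ := exists_deg_eq_intCast deg w
  simpa [htφ] using hker _ (mul_inv_zpow_mem_ker ht hk)

theorem inv_mul_mul_eq_of_mem_conjCore (ht : deg t = Multiplicative.ofAdd 1)
    (hx : x ∈ conjCore deg.ker H φ) {w : F} {k : ℤ}
    (hk : deg w = Multiplicative.ofAdd (k : ZMod n)) :
    (φ w)⁻¹ * x * φ w = (φ t ^ k)⁻¹ * x * φ t ^ k := by
  have conj_eq := (commute_of_mem_conjCore hx (mul_inv_zpow_mem_ker ht hk)).inv_mul_cancel
  conv_rhs => rw [← conj_eq]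
  simp [mul_assoc]

theorem exists_close_of_mul_pow_eq (ht : deg t = Multiplicative.ofAdd 1)
    (hx : x ∈ conjCore deg.ker H φ) (hpow : (φ t * x) ^ n = φ t ^ n) :
    ∃ ψ : F →* G, Close deg.ker H φ ψ ∧ ψ t = φ t * x := by
  let τ : ℤ → G := fun k => (φ t ^ k)⁻¹ * (φ t * x) ^ k
  have τ_mem (k : ℤ) : τ k ∈ conjCore deg.ker H φ :=
    inv_zpow_mul_mul_zpow_mem (map_mem_normalizer_conjCore t) hx k
  have τ_congr {k l : ℤ} (h : (k : ZMod n) = l) : τ k = τ l := inv_zpow_mul_zpow_congr hpow h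
  have τ_add (k l : ℤ) : τ (k + l) = (φ t ^ l)⁻¹ * τ k * φ t ^ l * τ l := by
    simp only [τ, zpow_add]
    group
  choose k hk using exists_deg_eq_intCast deg
  have τ_deg {w : F} {l : ℤ} (h : deg w = Multiplicative.ofAdd (l : ZMod n)) :
      τ (k w) = τ l := τ_congr (Multiplicative.ofAdd.injective ((hk w).symm.trans h))
  let ψ : F →* G := MonoidHom.mk' (fun w => φ w * τ (k w)) fun v w => by
    have hvw : τ (k (v * w)) = τ (k v + k w) := τ_deg (by
      rw [map_mul, hk, hk, ← ofAdd_add, Int.cast_add])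
    rw [map_mul, hvw, τ_add, ← inv_mul_mul_eq_of_mem_conjCore ht (τ_mem (k v)) (hk w)]
    group
  refine ⟨ψ, ⟨fun a ha => ?_, fun w => ?_⟩, ?_⟩
  · change φ a * τ (k a) = φ a
    rw [τ_deg (l := 0) (by simpa using ha)]
    simp [τ]
  · change (φ w)⁻¹ * (φ w * τ (k w)) ∈ conjCore deg.ker H φ
    rw [inv_mul_cancel_left]
    exact τ_mem _
  · change φ t * τ (k t) = φ t * x
    rw [τ_deg (l := 1) (by simpa using ht)]
    simp [τ]

theorem mul_pow_eq_pow_of_mem_conjCore (hH : Cardinal.mk H ∣ (n : Cardinal)) (t : F)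
    (hx : x ∈ conjCore deg.ker H φ) : (φ t * x) ^ n = φ t ^ n := by
  rcases eq_or_ne n 0 with rfl | hn
  · simp
  have : Finite H := Cardinal.mk_lt_aleph0_iff.1
    ((Cardinal.le_of_dvd (mod_cast hn) hH).trans_lt Cardinal.natCast_lt_aleph0)
  have card_dvd : Nat.card H ∣ n := by
    rwa [← Nat.cast_card, Cardinal.nat_coe_dvd_iff] at hH
  have : Finite (conjCore deg.ker H φ) := Finite.Set.subset (H : Set G) conjCore_le
  have t_pow_mem : t ^ n ∈ deg.ker := by
    rw [MonoidHom.mem_ker, map_pow, ← ofAdd_toAdd (deg t), ← ofAdd_nsmul]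
    simp
  refine mul_pow_eq_pow_of_mem_normalizer (map_mem_normalizer_conjCore t) hx
    ((Subgroup.card_dvd_of_le conjCore_le).trans card_dvd)
    (Subgroup.mem_centralizer_iff.2 fun y hy => ?_)
  rw [← map_pow]
  exact (commute_of_mem_conjCore hy t_pow_mem).symm

theorem mk_dvd_mk_of_close_mem {F G : Type u} [Group F] [Group G] {n : ℕ}
    {deg : F →* Multiplicative (ZMod n)} (hdeg : Function.Surjective deg) {H : Subgroup G}
    (hH : Cardinal.mk H ∣ (n : Cardinal.{u})) (Φ : SubMulAction H (F →* G))
    (hΦ : ∀ φ ∈ Φ, ∀ ψ, Close deg.ker H φ ψ → ψ ∈ Φ) : Cardinal.mk H ∣ Cardinal.mk Φ := by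
  obtain ⟨t, ht⟩ := hdeg (Multiplicative.ofAdd 1)
  let c : SMulCon H Φ :=
    { r := fun ψ φ => Close deg.ker H φ.1 ψ.1
      iseqv := ⟨fun _ => Close.refl _, Close.symm, fun h h' => h'.trans h⟩
      smul := fun h _ _ hc => hc.smul h.2 }
  refine mk_dvd_mk_of_smulCon c fun φ => ?_
  let core := conjCore deg.ker H φ.1
  have stabilizer_equiv : {h : H // c.toSetoid (h • φ) φ} ≃ core :=
    { toFun := fun h => ⟨h.1, (close_smul_iff h.1.2).1 h.2⟩
      invFun := fun h => ⟨⟨h.1, conjCore_le h.2⟩, (close_smul_iff (conjCore_le h.2)).2 h.2⟩ }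
  let class_to_core : {ψ : Φ // c.toSetoid ψ φ} → core :=
    fun ψ => ⟨(φ.1 t)⁻¹ * ψ.1.1 t, ψ.2.inv_mul_mem t⟩
  have class_to_core_injective : Function.Injective class_to_core := fun ψ χ h =>
    Subtype.ext <| Subtype.ext <| eq_of_eqOn_ker ht
      (fun a ha => (ψ.2.eqOn a ha).trans (χ.2.eqOn a ha).symm)
      (mul_left_cancel (congrArg Subtype.val h))
  have class_to_core_surjective : Function.Surjective class_to_core := fun ⟨x, hx⟩ => by
    obtain ⟨ψ, hψ, hψt⟩ :=
      exists_close_of_mul_pow_eq ht hx (mul_pow_eq_pow_of_mem_conjCore hH t hx)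
    exact ⟨⟨⟨ψ, hΦ _ φ.2 ψ hψ⟩, hψ⟩, Subtype.ext (inv_mul_eq_of_eq_mul hψt)⟩
  exact Cardinal.mk_congr ((Equiv.ofBijective class_to_core
    ⟨class_to_core_injective, class_to_core_surjective⟩).trans stabilizer_equiv.symm)

end Core

section Determinants

variable {R M N ι : Type*} [CommRing R] [AddCommGroup M] [Module R M] [AddCommGroup N] [Module R N]

theorem multilinearMap_mem_of_mem_span [Finite ι] (f : MultilinearMap R (fun _ : ι => M) N)
    {s : Set M} {P : Submodule R N} (h : ∀ x, (∀ i, x i ∈ s) → f x ∈ P) {x : ι → M}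
    (hx : ∀ i, x i ∈ Submodule.span R s) : f x ∈ P := by
  classical
  have := Fintype.ofFinite ι
  suffices ∀ (T : Finset ι) (x : ι → M), (∀ i ∈ T, x i ∈ Submodule.span R s) →
      (∀ i ∉ T, x i ∈ s) → f x ∈ P from this Finset.univ x (fun i _ => hx i) (by simp)
  intro T
  induction T using Finset.induction_on with
  | empty => exact fun x _ hx => h x fun i => hx i (Finset.notMem_empty i)
  | insert j T hj ih =>
    intro x hspan hmem
    have span_le : Submodule.span R s ≤ P.comap (f.toLinearMap x j) := by
      refine Submodule.span_le.2 fun v hv => ?_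
      refine ih (Function.update x j v) (fun i hi => ?_) (fun i hi => ?_)
      · rw [Function.update_of_ne (ne_of_mem_of_not_mem hi hj)]
        exact hspan i (Finset.mem_insert_of_mem hi)
      · rcases eq_or_ne i j with rfl | hij
        · rwa [Function.update_self]
        · rw [Function.update_of_ne hij]
          exact hmem i (by simp [hij, hi])
    simpa using span_le (hspan j (Finset.mem_insert_self j T))

variable [Fintype ι] [DecidableEq ι] {s : Set M} {d : R}

theorem dvd_det_of_mem_span_left (f : ι → M →ₗ[R] R)
    (h : ∀ x : ι → M, (∀ i, x i ∈ s) → d ∣ (Matrix.of fun i j => f j (x i)).det) {x : ι → M}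
    (hx : ∀ i, x i ∈ Submodule.span R s) : d ∣ (Matrix.of fun i j => f j (x i)).det := by
  simp only [← Ideal.mem_span_singleton] at h ⊢
  exact multilinearMap_mem_of_mem_span
    (Matrix.detRowAlternating.toMultilinearMap.compLinearMap fun _ => LinearMap.pi f) h hx

theorem dvd_det_of_mem_span (β : M →ₗ[R] N →ₗ[R] R) {t : Set N}
    (h : ∀ (x : ι → M) (y : ι → N), (∀ i, x i ∈ s) → (∀ j, y j ∈ t) →
      d ∣ (Matrix.of fun i j => β (x i) (y j)).det)
    {x : ι → M} {y : ι → N} (hx : ∀ i, x i ∈ Submodule.span R s)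
    (hy : ∀ j, y j ∈ Submodule.span R t) : d ∣ (Matrix.of fun i j => β (x i) (y j)).det := by
  refine dvd_det_of_mem_span_left (fun j => β.flip (y j)) (fun x hx => ?_) hx
  rw [← Matrix.det_transpose]
  refine dvd_det_of_mem_span_left (fun i => β (x i)) (fun y hy => ?_) hy
  rw [← Matrix.det_transpose]
  exact h x y hx hy

end Determinants

theorem dvd_Delta_iff {I : Type*} {m k : ℕ} {A : Matrix I (Fin m) ℤ} {d : ℤ} :
    d ∣ (Delta A k : ℤ) ↔ ∀ (r : Fin k → I) (c : Fin k → Fin m), d ∣ (A.submatrix r c).det := by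
  rw [Delta, dvd_gcdSet_iff]
  constructor
  · intro h r c
    by_cases hr : Function.Injective r
    · by_cases hc : Function.Injective c
      · exact h _ ⟨⟨r, hr⟩, ⟨c, hc⟩, rfl⟩
      · obtain ⟨i, j, hij, hne⟩ := Function.not_injective_iff.1 hc
        rw [Matrix.det_zero_of_column_eq hne fun l => by simp [hij]]
        exact dvd_zero d
    · obtain ⟨i, j, hij, hne⟩ := Function.not_injective_iff.1 hr
      rw [Matrix.det_zero_of_row_eq hne (by ext l; simp [hij])]
      exact dvd_zero d
  · rintro h _ ⟨r, c, rfl⟩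
    exact h r c

theorem Delta_dvd_Delta_of_mem_span {M N I J : Type*} [AddCommGroup M] [AddCommGroup N]
    {m l : ℕ} (β : M →ₗ[ℤ] N →ₗ[ℤ] ℤ) {x : I → M} {y : Fin m → N} {x' : J → M} {y' : Fin l → N}
    (hx : ∀ i, x' i ∈ Submodule.span ℤ (Set.range x))
    (hy : ∀ j, y' j ∈ Submodule.span ℤ (Set.range y)) (k : ℕ) :
    Delta (Matrix.of fun i j => β (x i) (y j)) k ∣
      Delta (Matrix.of fun i j => β (x' i) (y' j)) k := by
  rw [← Int.natCast_dvd_natCast, dvd_Delta_iff]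
  intro r c
  refine dvd_det_of_mem_span β (fun u v hu hv => ?_) (fun i => hx (r i)) (fun j => hy (c j))
  choose r' hr' using hu
  choose c' hc' using hv
  obtain rfl : x ∘ r' = u := funext hr'
  obtain rfl : y ∘ c' = v := funext hc'
  exact dvd_Delta_iff.1 dvd_rfl r' c'

theorem Delta_eq_Delta_of_span_eq {M N I J : Type*} [AddCommGroup M] [AddCommGroup N] {m l : ℕ}
    (β : M →ₗ[ℤ] N →ₗ[ℤ] ℤ) {x : I → M} {y : Fin m → N} {x' : J → M} {y' : Fin l → N}
    (hx : Submodule.span ℤ (Set.range x) = Submodule.span ℤ (Set.range x'))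
    (hy : Submodule.span ℤ (Set.range y) = Submodule.span ℤ (Set.range y')) (k : ℕ) :
    Delta (Matrix.of fun i j => β (x i) (y j)) k =
      Delta (Matrix.of fun i j => β (x' i) (y' j)) k :=
  Nat.dvd_antisymm
    (Delta_dvd_Delta_of_mem_span β (fun i => hx ▸ Submodule.subset_span ⟨i, rfl⟩)
      (fun j => hy ▸ Submodule.subset_span ⟨j, rfl⟩) k)
    (Delta_dvd_Delta_of_mem_span β (fun i => hx ▸ Submodule.subset_span ⟨i, rfl⟩)
      (fun j => hy ▸ Submodule.subset_span ⟨j, rfl⟩) k)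

theorem dvd_Delta_diagonal_iff {m k : ℕ} {a : Fin m → ℤ} {d : ℤ} :
    d ∣ (Delta (Matrix.diagonal a) k : ℤ) ↔
      ∀ s : Finset (Fin m), s.card = k → d ∣ ∏ i ∈ s, a i := by
  rw [Delta, dvd_gcdSet_iff]
  constructor
  · intro h s hs
    refine h _ ⟨(s.orderEmbOfFin hs).toEmbedding, (s.orderEmbOfFin hs).toEmbedding, ?_⟩
    conv_lhs => rw [← Finset.map_orderEmbOfFin_univ s hs]
    rw [Matrix.submatrix_diagonal_embedding, Matrix.det_diagonal, Finset.prod_map]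
    rfl
  · rintro h _ ⟨r, c, rfl⟩
    rw [Matrix.det_apply]
    refine Finset.dvd_sum fun σ _ => dvd_smul_of_dvd _ ?_
    by_cases hσ : ∀ i, r (σ i) = c i
    · have prod_eq : ∏ i, (Matrix.diagonal a).submatrix r c (σ i) i =
          ∏ i ∈ Finset.univ.map c, a i := by
        simp [hσ]
      rw [prod_eq]
      exact h _ (by simp)
    · obtain ⟨i, hi⟩ := not_forall.1 hσ
      rw [Finset.prod_eq_zero (Finset.mem_univ i) (Matrix.diagonal_apply_ne a hi)]
      exact dvd_zero d

theorem dvd_Delta_diagonal_self_iff {m : ℕ} {a : Fin m → ℤ} {d : ℤ} :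
    d ∣ (Delta (Matrix.diagonal a) m : ℤ) ↔ d ∣ ∏ i, a i := by
  refine dvd_Delta_diagonal_iff.trans ⟨fun h => h _ (Finset.card_fin m), fun h s hs => ?_⟩
  rwa [Finset.eq_univ_of_card s (by rw [hs, Fintype.card_fin])]

theorem dvd_Delta_diagonal_pred_iff {m : ℕ} (hm : 1 ≤ m) {a : Fin m → ℤ} {d : ℤ} :
    d ∣ (Delta (Matrix.diagonal a) (m - 1) : ℤ) ↔ ∀ j, d ∣ ∏ i ∈ Finset.univ.erase j, a i := by
  refine dvd_Delta_diagonal_iff.trans ⟨fun h j => h _ (by simp), fun h s hs => ?_⟩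
  obtain ⟨j, hj⟩ : ∃ j, sᶜ = {j} := Finset.card_eq_one.1 (by
    rw [Finset.card_compl, Fintype.card_fin, hs, Nat.sub_sub_self hm])
  rw [← compl_compl s, hj, Finset.compl_singleton]
  exact h j

theorem exists_basis_span_smul_eq {R M ι : Type*} [CommRing R] [IsDomain R]
    [IsPrincipalIdealRing R] [AddCommGroup M] [Module R M] [Finite ι]
    (b : Module.Basis ι R M) (L : Submodule R M) :
    ∃ (b' : Module.Basis ι R M) (a : ι → R),
      Submodule.span R (Set.range fun i => a i • b' i) = L := by
  obtain ⟨n, b', c, f, a, hc⟩ := L.smithNormalForm b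
  have span_c : Submodule.span R (Set.range fun l => (c l : M)) = L := by
    rw [Set.range_comp' Subtype.val c, ← L.coe_subtype, Submodule.span_image, c.span_eq,
      Submodule.map_subtype_top]
  refine ⟨b', Function.extend f a 0, le_antisymm (Submodule.span_le.2 ?_) ?_⟩
  · rintro _ ⟨i, rfl⟩
    by_cases hi : ∃ l, f l = i
    · obtain ⟨l, rfl⟩ := hi
      simp only [f.injective.extend_apply, ← hc]
      exact (c l).2
    · simp [Function.extend_apply' _ _ _ hi]
  · rw [← span_c]
    refine Submodule.span_mono ?_
    rintro _ ⟨l, rfl⟩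
    exact ⟨f l, by simp only [f.injective.extend_apply, hc]⟩

theorem surjective_of_forall_dvd_isUnit {R M : Type*} [CommRing R] [IsPrincipalIdealRing R]
    [AddCommGroup M] [Module R M] {f : M →ₗ[R] R} (h : ∀ e, (∀ x, e ∣ f x) → IsUnit e) :
    Function.Surjective f := by
  obtain ⟨e, he⟩ := IsPrincipalIdealRing.principal (LinearMap.range f)
  rw [← LinearMap.range_eq_top, he, Ideal.submodule_span_eq, Ideal.span_singleton_eq_top]
  refine h e fun x => Ideal.mem_span_singleton.1 ?_
  rw [← Ideal.submodule_span_eq, ← he]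
  exact LinearMap.mem_range_self f x

theorem exists_surjective_dvd_of_basis {M : Type*} [AddCommGroup M] {m : ℕ} (hm : 1 ≤ m)
    (b : Module.Basis (Fin m) ℤ M) (a : Fin m → ℤ) :
    ∃ E : M →ₗ[ℤ] ℤ, Function.Surjective E ∧
      ∀ j, ((Delta (Matrix.diagonal a) m / Delta (Matrix.diagonal a) (m - 1) : ℕ) : ℤ) ∣
        E (a j • b j) := by
  set D := Delta (Matrix.diagonal a) m
  set g := Delta (Matrix.diagonal a) (m - 1)
  choose c hc using (dvd_Delta_diagonal_pred_iff hm).1 (dvd_refl (g : ℤ))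
  have prod_eq (j : Fin m) : ∏ i, a i = g * (a j * c j) := by
    rw [mul_left_comm, ← hc, Finset.mul_prod_erase _ _ (Finset.mem_univ j)]
  rcases eq_or_ne g 0 with hg | hg
  · -- The quotient is `D / 0 = 0`, so `E` has to vanish on all the `a j • b j`.
    obtain ⟨j, -, hj⟩ : ∃ j ∈ Finset.univ, a j = 0 := Finset.prod_eq_zero_iff.1 (by
      rw [prod_eq ⟨0, hm⟩, hg, Nat.cast_zero, zero_mul])
    refine ⟨b.coord j, fun z => ⟨z • b j, by simp⟩, fun i => ?_⟩
    rcases eq_or_ne i j with rfl | hij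
    · simp [hj]
    · simp [hij]
  · have hg' : (g : ℤ) ≠ 0 := mod_cast hg
    have g_dvd_D : g ∣ D := Int.natCast_dvd_natCast.1 <| dvd_Delta_diagonal_self_iff.2 <|
      prod_eq ⟨0, hm⟩ ▸ dvd_mul_right _ _
    refine ⟨b.constr ℤ c, surjective_of_forall_dvd_isUnit fun e he => ?_, fun j => ?_⟩
    · have mul_dvd_g : g * e ∣ (g : ℤ) := (dvd_Delta_diagonal_pred_iff hm).2 fun j =>
        hc j ▸ mul_dvd_mul_left _ (by simpa using he (b j))
      exact isUnit_of_dvd_one ((mul_dvd_mul_iff_left hg').1 (by rwa [mul_one]))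
    · rw [map_smul, b.constr_basis, smul_eq_mul, ← mul_dvd_mul_iff_left hg', ← prod_eq j,
        ← Nat.cast_mul, Nat.mul_div_cancel' g_dvd_D]
      exact dvd_Delta_diagonal_self_iff.1 dvd_rfl

theorem exists_surjective_dvd {I : Type*} {m : ℕ} (hm : 1 ≤ m) (A : Matrix I (Fin m) ℤ) :
    ∃ E : (Fin m → ℤ) →ₗ[ℤ] ℤ, Function.Surjective E ∧
      ∀ i, ((Delta A m / Delta A (m - 1) : ℕ) : ℤ) ∣ E (A i) := by
  let e := Pi.basisFun ℤ (Fin m)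
  obtain ⟨b, a, hspan⟩ := exists_basis_span_smul_eq e (Submodule.span ℤ (Set.range A))
  let β : (Fin m → ℤ) →ₗ[ℤ] Module.Dual ℤ (Fin m → ℤ) →ₗ[ℤ] ℤ := Module.Dual.eval ℤ _
  have A_eq : A = Matrix.of fun i j => β (A i) (e.coord j) := by
    ext i j
    simp [β, e]
  have diagonal_eq : Matrix.diagonal a = Matrix.of fun i j => β (a i • b i) (b.coord j) := by
    ext i j
    simp [β, Matrix.diagonal_apply, Finsupp.single_apply, -zsmul_eq_mul]
  have span_coord :
      Submodule.span ℤ (Set.range e.coord) = Submodule.span ℤ (Set.range b.coord) := by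
    rw [← e.coe_dualBasis, ← b.coe_dualBasis, e.dualBasis.span_eq, b.dualBasis.span_eq]
  have Delta_eq (k : ℕ) : Delta A k = Delta (Matrix.diagonal a) k :=
    calc
      Delta A k = Delta (Matrix.of fun i j => β (A i) (e.coord j)) k := by rw [← A_eq]
      _ = Delta (Matrix.of fun i j => β (a i • b i) (b.coord j)) k :=
        Delta_eq_Delta_of_span_eq β hspan.symm span_coord k
      _ = Delta (Matrix.diagonal a) k := by rw [← diagonal_eq]
  obtain ⟨E, hE, dvd_E⟩ := exists_surjective_dvd_of_basis hm b a
  rw [← Delta_eq, ← Delta_eq] at dvd_E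
  have span_le : Submodule.span ℤ (Set.range A) ≤
      Submodule.comap E (Ideal.span {((Delta A m / Delta A (m - 1) : ℕ) : ℤ)}) := by
    rw [← hspan, Submodule.span_le]
    rintro _ ⟨j, rfl⟩
    exact Ideal.mem_span_singleton.2 (dvd_E j)
  exact ⟨E, hE, fun i => Ideal.mem_span_singleton.1 (span_le (Submodule.subset_span ⟨i, rfl⟩))⟩

section FreeGroup

variable {G : Type u} {m : ℕ}

/-- A letter as an element of the free group on `G` and the unknowns, in which the coefficients
become free generators. -/
def Letter.toFreeGroup : Letter G m → FreeGroup (G ⊕ Fin m)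
  | .coeff g => FreeGroup.of (Sum.inl g)
  | .unknown j => FreeGroup.of (Sum.inr j)
  | .unknownInv j => (FreeGroup.of (Sum.inr j))⁻¹

/-- A word as an element of the free group on `G` and the unknowns, so that the values of the word
are its images under homomorphisms. -/
def Word.toFreeGroup (w : Word G m) : FreeGroup (G ⊕ Fin m) :=
  (w.map Letter.toFreeGroup).prod

variable (G m) in
/-- The homomorphism sending an element of the free group on `G` and the unknowns to its vector of
exponent sums in the unknowns. -/
def exponentHom : FreeGroup (G ⊕ Fin m) →* Multiplicative (Fin m → ℤ) :=
  FreeGroup.lift (Sum.elim (fun _ => 1) fun j => Multiplicative.ofAdd (Pi.single j 1))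

theorem exponentHom_of_inl (g : G) : exponentHom G m (FreeGroup.of (Sum.inl g)) = 1 := by
  simp [exponentHom]

theorem exponentHom_of_inr (j : Fin m) :
    exponentHom G m (FreeGroup.of (Sum.inr j)) = Multiplicative.ofAdd (Pi.single j 1) := by
  simp [exponentHom]

theorem exponentHom_toFreeGroup (w : Word G m) :
    exponentHom G m w.toFreeGroup = Multiplicative.ofAdd w.exponentSum := by
  have exponentHom_letter (l : Letter G m) :
      exponentHom G m l.toFreeGroup = Multiplicative.ofAdd fun j => l.exponent j := by
    cases l with
    | coeff g => exact exponentHom_of_inl g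
    | unknown i =>
      refine (exponentHom_of_inr i).trans (congrArg Multiplicative.ofAdd (funext fun j => ?_))
      simp [Letter.exponent, Pi.single_apply, eq_comm]
    | unknownInv i =>
      rw [Letter.toFreeGroup, map_inv, exponentHom_of_inr, ← ofAdd_neg]
      refine congrArg Multiplicative.ofAdd (funext fun j => ?_)
      simp only [Letter.exponent, Pi.neg_apply, Pi.single_apply, eq_comm, neg_ite, neg_zero]
  induction w with
  | nil => rfl
  | cons l w ih =>
    calc
      exponentHom G m (Word.toFreeGroup (l :: w)) =
          exponentHom G m l.toFreeGroup * exponentHom G m (Word.toFreeGroup w) := by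
        rw [Word.toFreeGroup, List.map_cons, List.prod_cons, map_mul, Word.toFreeGroup]
      _ = Multiplicative.ofAdd ((fun j => l.exponent j) + Word.exponentSum w) := by
        rw [exponentHom_letter, ih, ofAdd_add]
      _ = Multiplicative.ofAdd (Word.exponentSum (l :: w)) := rfl

theorem exponentHom_surjective : Function.Surjective (exponentHom G m) := fun v => by
  refine ⟨(List.ofFn fun j => FreeGroup.of (Sum.inr j) ^ v.toAdd j).prod, ?_⟩
  rw [map_list_prod, List.map_ofFn, List.prod_ofFn]
  simp only [Function.comp_apply, map_zpow, exponentHom_of_inr, ← ofAdd_zsmul, ← ofAdd_sum]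
  exact congrArg Multiplicative.ofAdd (pi_eq_sum_univ' v.toAdd).symm

variable [Group G] {I : Type v} {S : System G I m}

theorem Word.map_toFreeGroup_eq_eval {φ : FreeGroup (G ⊕ Fin m) →* G} {w : Word G m}
    (h : ∀ g, Letter.coeff g ∈ w → φ (FreeGroup.of (Sum.inl g)) = g) :
    φ w.toFreeGroup = w.eval fun j => φ (FreeGroup.of (Sum.inr j)) := by
  rw [Word.toFreeGroup, Word.eval, map_list_prod, List.map_map]
  congr 1
  refine List.map_congr_left fun l hl => ?_
  cases l with
  | coeff g => exact h g hl
  | unknown j => rfl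
  | unknownInv j => exact map_inv φ _

/-- The homomorphisms that correspond to the solutions of a system. The elements of `G` that are not
coefficients are sent to `1` rather than to themselves, so that these homomorphisms are permuted
by the centralizer of the coefficients. -/
def System.homs (S : System G I m) : Set (FreeGroup (G ⊕ Fin m) →* G) :=
  {φ | (∀ g, φ (FreeGroup.of (Sum.inl g)) = S.coefficients.mulIndicator id g) ∧
    ∀ i, φ (S i).toFreeGroup = 1}

theorem System.map_toFreeGroup_eq_eval {φ : FreeGroup (G ⊕ Fin m) →* G}
    (h : ∀ g, φ (FreeGroup.of (Sum.inl g)) = S.coefficients.mulIndicator id g) (i : I) :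
    φ (S i).toFreeGroup = (S i).eval fun j => φ (FreeGroup.of (Sum.inr j)) :=
  Word.map_toFreeGroup_eq_eval fun g hg =>
    (h g).trans (Set.mulIndicator_of_mem (s := S.coefficients) ⟨i, hg⟩ id)

theorem System.mk_homs (S : System G I m) : Cardinal.mk S.homs = Cardinal.mk S.solutions := by
  let values (φ : S.homs) : S.solutions :=
    ⟨fun j => φ.1 (FreeGroup.of (Sum.inr j)), fun i =>
      (System.map_toFreeGroup_eq_eval φ.2.1 i).symm.trans (φ.2.2 i)⟩
  refine Cardinal.mk_congr (Equiv.ofBijective values ⟨fun φ ψ h => ?_, fun x => ?_⟩)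
  · refine Subtype.ext (FreeGroup.ext_hom _ _ ?_)
    rintro (g | j)
    · rw [φ.2.1, ψ.2.1]
    · exact congrFun (congrArg Subtype.val h) j
  · let φ : FreeGroup (G ⊕ Fin m) →* G :=
      FreeGroup.lift (Sum.elim (S.coefficients.mulIndicator id) x.1)
    have φ_inl (g : G) : φ (FreeGroup.of (Sum.inl g)) = S.coefficients.mulIndicator id g :=
      FreeGroup.lift_apply_of
    have φ_inr : (fun j => φ (FreeGroup.of (Sum.inr j))) = x.1 :=
      funext fun _ => FreeGroup.lift_apply_of
    refine ⟨⟨φ, φ_inl, fun i => ?_⟩, Subtype.ext φ_inr⟩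
    rw [System.map_toFreeGroup_eq_eval φ_inl, φ_inr]
    exact x.2 i

theorem System.smul_mem_homs {φ : FreeGroup (G ⊕ Fin m) →* G} {h : G} (hφ : φ ∈ S.homs)
    (hh : h ∈ Subgroup.centralizer S.coefficients) : h • φ ∈ S.homs := by
  refine ⟨fun g => ?_, fun i => ?_⟩
  · rw [conj_smul_apply, hφ.1, mul_inv_eq_iff_eq_mul]
    by_cases hg : g ∈ S.coefficients
    · rw [Set.mulIndicator_of_mem hg]
      exact (Subgroup.mem_centralizer_iff.1 hh g hg).symm
    · rw [Set.mulIndicator_of_notMem hg, one_mul, mul_one]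
  · rw [conj_smul_apply, hφ.2, mul_one, mul_inv_cancel]

theorem System.mem_homs_of_eqOn {N : Subgroup (FreeGroup (G ⊕ Fin m))}
    {φ ψ : FreeGroup (G ⊕ Fin m) →* G} (hinl : ∀ g, FreeGroup.of (Sum.inl g) ∈ N)
    (hS : ∀ i, (S i).toFreeGroup ∈ N) (hφ : φ ∈ S.homs) (h : ∀ a ∈ N, ψ a = φ a) :
    ψ ∈ S.homs :=
  ⟨fun g => (h _ (hinl g)).trans (hφ.1 g), fun i => (h _ (hS i)).trans (hφ.2 i)⟩

theorem mk_subgroup_dvd_mk_solutions {n : ℕ} {E : (Fin m → ℤ) →ₗ[ℤ] ℤ}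
    (hE : Function.Surjective E) (hn : ∀ i, (n : ℤ) ∣ E (S.matrix i)) {H : Subgroup G}
    (hHC : H ≤ Subgroup.centralizer S.coefficients) (hH : Cardinal.mk H ∣ (n : Cardinal.{u})) :
    Cardinal.mk H ∣ Cardinal.mk S.solutions := by
  let degree : (Fin m → ℤ) →+ ZMod n := (Int.castAddHom (ZMod n)).comp E.toAddMonoidHom
  let deg : FreeGroup (G ⊕ Fin m) →* Multiplicative (ZMod n) :=
    degree.toMultiplicative.comp (exponentHom G m)
  have deg_surjective : Function.Surjective deg :=
    ((ZMod.intCast_surjective (n := n)).comp hE).comp exponentHom_surjective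
  have inl_mem_ker (g : G) : FreeGroup.of (Sum.inl g) ∈ deg.ker := by
    rw [MonoidHom.mem_ker, MonoidHom.comp_apply, exponentHom_of_inl, map_one]
  have equation_mem_ker (i : I) : (S i).toFreeGroup ∈ deg.ker := by
    rw [MonoidHom.mem_ker, MonoidHom.comp_apply, exponentHom_toFreeGroup]
    exact (ZMod.intCast_zmod_eq_zero_iff_dvd _ n).2 (hn i)
  let Φ : SubMulAction H (FreeGroup (G ⊕ Fin m) →* G) :=
    { carrier := S.homs
      smul_mem' := fun h _ hφ => System.smul_mem_homs hφ (hHC h.2) }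
  rw [← S.mk_homs]
  exact mk_dvd_mk_of_close_mem deg_surjective hH Φ fun φ hφ ψ hψ =>
    System.mem_homs_of_eqOn inl_mem_ker equation_mem_ker hφ hψ.eqOn

end FreeGroup

end GroupEquations

theorem theorem1 {G : Type u} [Group G] {I : Type v} {m : ℕ} (hm : 1 ≤ m)
    (S : GroupEquations.System G I m) :
    GroupEquations.groupGcd (Subgroup.centralizer S.coefficients)
        (GroupEquations.Delta S.matrix m / GroupEquations.Delta S.matrix (m - 1)) ∣
      Cardinal.mk S.solutions := by
  obtain ⟨E, hE, dvd_E⟩ := GroupEquations.exists_surjective_dvd hm S.matrix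
  exact GroupEquations.groupGcd_dvd_of_forall_le fun H hHC hH =>
    GroupEquations.mk_subgroup_dvd_mk_solutions hE dvd_E hHC hH
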